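/- Graphs are finite and undirected, without parallel edges; loops are allowed. A homomorphism $G\to H$ is a map $V(G)\to V(H)$ that sends edges to edges. The direct product $G\times H$ has vertex set $V(G)\times V(H)$, with $(x,y)$ and $(x',y')$ adjacent iff $xx'\in E(G)$ and $yy'\in E(H)$; $G^m$ is the direct product of $m$ copies of $G$. Let $K_1^*$ be the graph with one vertex and a loop at it. A core is a graph with no homomorphism to any of its proper subgraphs; a core is trivial if it is isomorphic to $K_1$, $K_1^*$ or $K_2$. Two graphs are incomparable if there is no homomorphism from either one to the other. A graph $G$ is truly projective if it has at least three vertices and, for every $s\ge 2$ and every connected core $W$ incomparable with $G$, every homomorphism $f:G^s\times W\to G$ with $f(x,\dots,x,y)=x$ for all $x\in V(G)$, $y\in V(W)$ is a projection onto one of the coordinates. **Lemma.** Let $H=H_1\times R$ be a connected non-trivial core such that $H_1$ is truly projective and $R\not\simeq K_1^*$, and let $w$ be a vertex of $R$. Then there exist a graph $F$ and vertices $u^*,v^*$ of $F$ such that (a) for all $x,y\in V(H_1)$ with $xy\in E(H_1)$ there is a homomorphism $f:F\to H$ with $f(u^*)=(x,w)$ and $f(v^*)=(y,w)$; (b) for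 every homomorphism $f:F\to H$, the first coordinates of $f(u^*)$ and $f(v^*)$ are adjacent in $H_1$. Moreover, one can take $F=H_1^{2s}\times R$ with $s=|E(H_1)|$. -/

import Mathlib

/-- Undirected graphs without parallel edges on the vertex set `V`, loops being allowed. -/
structure LoopGraph (V : Type*) where
  Adj : V → V → Prop
  symm : ∀ ⦃a b : V⦄, Adj a b → Adj b a

namespace LoopGraph

/-- Graph homomorphisms: maps of vertices that send edges to edges. -/
abbrev Hom {V W : Type*} (G : LoopGraph V) (H : LoopGraph W) : Type _ :=
  G.Adj →r H.Adj

/-- Graph isomorphisms: bijections of vertices that preserve and reflect edges. -/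
abbrev Iso {V W : Type*} (G : LoopGraph V) (H : LoopGraph W) : Type _ :=
  G.Adj ≃r H.Adj

/-- The set of edges, as unordered pairs of vertices (a loop at `x` is the pair `{x, x}`). -/
def edgeSet {V : Type*} (G : LoopGraph V) : Set (Sym2 V) :=
  {e | ∃ x y : V, G.Adj x y ∧ e = s(x, y)}

/-- The direct product of two graphs. -/
def prod {V W : Type*} (G : LoopGraph V) (H : LoopGraph W) : LoopGraph (V × W) where
  Adj p q := G.Adj p.1 q.1 ∧ H.Adj p.2 q.2
  symm := fun _ _ h => ⟨G.symm h.1, H.symm h.2⟩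

/-- The direct product of `m` copies of a graph. -/
def pow {V : Type*} (G : LoopGraph V) (m : ℕ) : LoopGraph (Fin m → V) where
  Adj p q := ∀ i, G.Adj (p i) (q i)
  symm := fun _ _ h i => G.symm (h i)

/-- The complete graph without loops on `n` vertices. -/
def complete (n : ℕ) : LoopGraph (Fin n) where
  Adj a b := a ≠ b
  symm := fun _ _ h => h.symm

/-- The graph with one vertex and a loop at it. -/
def loopVertex : LoopGraph Unit where
  Adj _ _ := True
  symm := fun _ _ _ => trivial

/-- A graph is connected if it has a vertex and any two vertices are joined by a walk. -/
def Connected {V : Type*} (G : LoopGraph V) : Prop :=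
  Nonempty V ∧ ∀ a b : V, Relation.ReflTransGen G.Adj a b

/-- `K`, a graph on the set `S` of vertices of `G`, is a subgraph of `G`. -/
def IsSubgraph {V : Type*} (G : LoopGraph V) (S : Set V) (K : LoopGraph S) : Prop :=
  ∀ a b : S, K.Adj a b → G.Adj a b

/-- `K`, a graph on the set `S` of vertices of `G`, is a subgraph of `G` that lacks some vertex
or some edge of `G`. -/
def IsProperSubgraph {V : Type*} (G : LoopGraph V) (S : Set V) (K : LoopGraph S) : Prop :=
  G.IsSubgraph S K ∧ (S ≠ Set.univ ∨ ∃ a b : S, G.Adj a b ∧ ¬ K.Adj a b)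

/-- A graph is a core if it has no homomorphism to any of its proper subgraphs. -/
def IsCore {V : Type*} (G : LoopGraph V) : Prop :=
  ∀ (S : Set V) (K : LoopGraph S), G.IsProperSubgraph S K → IsEmpty (G.Hom K)

/-- The trivial graphs: a single vertex, with or without a loop, and a single edge. -/
def IsTrivial {V : Type*} (G : LoopGraph V) : Prop :=
  Nonempty (G.Iso (complete 1)) ∨ Nonempty (G.Iso loopVertex) ∨ Nonempty (G.Iso (complete 2))

/-- Two graphs are incomparable if there is no homomorphism between them in either direction. -/
def Incomparable {V W : Type*} (G : LoopGraph V) (H : LoopGraph W) : Prop :=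
  IsEmpty (G.Hom H) ∧ IsEmpty (H.Hom G)

/-- `H` has at least three vertices, and for every `s ≥ 2` and every finite connected core `W`
incomparable with `H`, every homomorphism `f : H ^ s × W → H` with `f (x, …, x, y) = x` for all
`x`, `y` is a projection. Every finite graph is isomorphic to one whose vertices form a type in
the lowest universe, so `W` ranges over all finite graphs. -/
def TrulyProjective {V : Type*} (H : LoopGraph V) : Prop :=
  3 ≤ Nat.card V ∧
    ∀ s : ℕ, 2 ≤ s → ∀ (T : Type) [Finite T] (W : LoopGraph T),
      W.Connected → W.IsCore → Incomparable W H →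
        ∀ f : Hom ((H.pow s).prod W) H,
          (∀ (x : V) (y : T), f (fun _ => x, y) = x) →
            ∃ i : Fin s, ∀ p : (Fin s → V) × T, f p = p.1 i

end LoopGraph

namespace LoopGraph

variable {V W : Type*}

/-! List the ordered adjacent pairs of $H_1$ along the $2s$ coordinates; let $u^*$ collect the first
ends, $v^*$ the second ends, both with $R$-coordinate $w$. Projections of $F$ then realise every
edge, which gives (a).

For (b), the first coordinate of any $f:F\to H$ must be $\alpha(x_i)$ for an endomorphism $\alpha$
of $H_1$ and an index $i$ (`exists_fst_eq`). On the diagonal, $f$ is an endomorphism $\sigma$ of the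
core $H$, hence an automorphism. If its first coordinate depends only on the first argument
(`fst_endomorphism`), it defines an automorphism $\alpha$, and true projectivity applies to
$\alpha^{-1}$ after the first coordinate of $f$. That independence is itself obtained from true
projectivity with exponent 2. -/

/-! ### Endomorphisms of finite cores -/

theorem surjective_of_isCore {G : LoopGraph V} (h : G.IsCore) (f : G.Hom G) :
    Function.Surjective f := by
  by_contra hs
  have hne : Set.range f ≠ Set.univ := fun e => hs (Set.range_eq_univ.1 e)
  refine (h (Set.range f) ⟨fun a b => G.Adj a b, fun a b hab => G.symm hab⟩
    ⟨fun a b hab => hab, Or.inl hne⟩).false ⟨fun x => ⟨f x, x, rfl⟩, fun hab => f.map_rel hab⟩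

/-- A surjective endomorphism of a finite graph has an inverse homomorphism. -/
theorem exists_inverse_hom [Finite V] {G : LoopGraph V} (f : G.Hom G)
    (hf : Function.Surjective f) :
    ∃ g : G.Hom G, (∀ x, g (f x) = x) ∧ ∀ x, f (g x) = x := by
  have hb : Function.Bijective f := ⟨Finite.injective_iff_surjective.2 hf, hf⟩
  let e : Equiv.Perm V := Equiv.ofBijective f hb
  -- The inverse is a power of the permutation, so it preserves edges.
  obtain ⟨n, hn, he⟩ := (isOfFinOrder_of_finite e).exists_pow_eq_one
  have hpow : ∀ k : ℕ, ∀ a b, G.Adj a b → G.Adj ((e ^ k) a) ((e ^ k) b) := by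
    intro k
    induction k with
    | zero => intro a b h; simpa using h
    | succ k ih =>
      intro a b h
      rw [pow_succ]
      exact ih _ _ (f.map_rel h)
  obtain ⟨m, rfl⟩ : ∃ m, n = m + 1 := ⟨n - 1, by omega⟩
  refine ⟨⟨fun x => (e ^ m) x, fun {a b} h => hpow m a b h⟩, fun x => ?_, fun x => ?_⟩
  · have : (e ^ m * e) x = x := by rw [← pow_succ, he]; rfl
    exact this
  · have : (e * e ^ m) x = x := by rw [← pow_succ', he]; rfl
    exact this

theorem isCore_of_surjective [Finite V] {G : LoopGraph V}
    (h : ∀ f : G.Hom G, Function.Surjective f) : G.IsCore := by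
  rintro S K ⟨hK, hp⟩
  refine ⟨fun f => ?_⟩
  let f' : G.Hom G := ⟨fun x => (f x : V), fun hab => hK _ _ (f.map_rel hab)⟩
  obtain ⟨g, -, hr⟩ := exists_inverse_hom f' (h f')
  rcases hp with hS | ⟨a, b, hab, hn⟩
  · exact hS (Set.eq_univ_of_forall fun x => hr x ▸ (f (g x)).2)
  · have key := f.map_rel (g.map_rel hab)
    have ha : f (g a) = a := Subtype.ext (hr a)
    have hb : f (g b) = b := Subtype.ext (hr b)
    rw [ha, hb] at key
    exact hn key

/-- Otherwise moving `a` to `b` and fixing all else is an endomorphism that misses `a`. -/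
theorem IsCore.eq_of_neighbors_subset [Finite V] {G : LoopGraph V} (h : G.IsCore) {a b : V}
    (hab : ∀ c, G.Adj a c → G.Adj b c) : a = b := by
  classical
  by_contra hne
  have hs := surjective_of_isCore h
    ⟨fun x => if x = a then b else x, by
      intro x y hxy
      by_cases hx : x = a <;> by_cases hy : y = a
      · subst hx; subst hy
        simpa using hab _ (G.symm (hab _ hxy))
      · subst hx; simpa [hy] using hab _ hxy
      · subst hy; simpa [hx] using G.symm (hab _ (G.symm hxy))
      · simpa [hx, hy] using hxy⟩
  obtain ⟨x, hx⟩ := hs a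
  change (if x = a then b else x) = a at hx
  split_ifs at hx with hxa
  · exact hne hx.symm
  · exact hxa hx

theorem isCore_of_prod_left [Finite V] [Finite W] {G : LoopGraph V} {H : LoopGraph W} [Nonempty W]
    (h : (G.prod H).IsCore) : G.IsCore := by
  refine isCore_of_surjective fun f x => ?_
  obtain ⟨w⟩ := ‹Nonempty W›
  obtain ⟨p, hp⟩ := surjective_of_isCore h
    ⟨fun p => (f p.1, p.2), fun hpq => ⟨f.map_rel hpq.1, hpq.2⟩⟩ (x, w)
  exact ⟨p.1, congrArg Prod.fst hp⟩

theorem isCore_of_prod_right [Finite V] [Finite W] {G : LoopGraph V} {H : LoopGraph W} [Nonempty V]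
    (h : (G.prod H).IsCore) : H.IsCore := by
  refine isCore_of_surjective fun f x => ?_
  obtain ⟨v⟩ := ‹Nonempty V›
  obtain ⟨p, hp⟩ := surjective_of_isCore h
    ⟨fun p => (p.1, f p.2), fun hpq => ⟨hpq.1, f.map_rel hpq.2⟩⟩ (v, x)
  exact ⟨p.2, congrArg Prod.snd hp⟩

theorem Connected.exists_adj [Nontrivial V] {G : LoopGraph V} (h : G.Connected) (a : V) :
    ∃ b, G.Adj a b := by
  obtain ⟨b, hb⟩ := exists_ne a
  rcases Relation.ReflTransGen.cases_head (h.2 a b) with e | ⟨c, hc, -⟩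
  · exact absurd e.symm hb
  · exact ⟨c, hc⟩

theorem Connected.of_prod_right {G : LoopGraph V} {H : LoopGraph W} (h : (G.prod H).Connected) :
    H.Connected := by
  obtain ⟨v, w⟩ := h.1.some
  exact ⟨⟨w⟩, fun a b => (h.2 (v, a) (v, b)).lift Prod.snd fun _ _ hpq => hpq.2⟩

/-! ### Walks of even length -/

/-- Being joined by a walk of even length. -/
def EvenReach (G : LoopGraph V) : V → V → Prop :=
  Relation.ReflTransGen fun a b => ∃ m, G.Adj a m ∧ G.Adj m b

theorem EvenReach.symm {G : LoopGraph V} {a b : V} (h : G.EvenReach a b) : G.EvenReach b a := by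
  induction h with
  | refl => exact .refl
  | tail _ hs ih =>
    obtain ⟨m, h₁, h₂⟩ := hs
    exact .head ⟨m, G.symm h₂, G.symm h₁⟩ ih

theorem EvenReach.shift {G : LoopGraph V} {a b : V} (h : G.EvenReach a b) :
    ∀ {a' b' : V}, G.Adj a a' → G.Adj b b' → G.EvenReach a' b' := by
  induction h with
  | refl => intro a' b' ha hb; exact .single ⟨a, G.symm ha, hb⟩
  | tail _ hs ih =>
    obtain ⟨m, h₁, h₂⟩ := hs
    intro a' b' ha hb
    exact (ih ha h₁).tail ⟨_, h₂, hb⟩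

/-- A connected graph that cannot be mapped to an edge has even walks between all vertices. -/
theorem Connected.evenReach {G : LoopGraph V} (h : G.Connected) {H : LoopGraph W} {p q : W}
    (hpq : H.Adj p q) (hG : IsEmpty (G.Hom H)) (a b : V) : G.EvenReach a b := by
  classical
  have dich : ∀ t, G.EvenReach a t ∨ ∃ z, G.Adj z t ∧ G.EvenReach a z := by
    intro t
    induction h.2 a t with
    | refl => exact .inl .refl
    | tail _ hs ih =>
      rcases ih with ih | ⟨z, hz, hr⟩
      · exact .inr ⟨_, hs, ih⟩
      · exact .inl (hr.tail ⟨_, hz, hs⟩)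
  by_contra hb
  have odd : ∀ y z, G.Adj y z → G.EvenReach a y → ¬ G.EvenReach a z := by
    intro y z hyz hy hz
    rcases dich b with hb' | ⟨t, ht, hr⟩
    · exact hb hb'
    · have hzt : G.EvenReach z t := hz.symm.trans hr
      exact hb (hy.trans (hzt.shift (G.symm hyz) ht))
  -- Parity of walks from `a` is a proper 2-colouring, with colours `p` and `q`.
  refine hG.false ⟨fun y => if G.EvenReach a y then p else q, ?_⟩
  intro y z hyz
  by_cases hy : G.EvenReach a y
  · simpa [hy, odd y z hyz hy] using hpq
  · have hz : G.EvenReach a z := by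
      rcases dich y with hy' | ⟨t, ht, hr⟩
      · exact absurd hy' hy
      · exact hr.tail ⟨y, ht, hyz⟩
    simpa [hy, hz] using H.symm hpq

/-! ### True projectivity and products -/

/-- The defining property of truly projective graphs, with `W` in any universe. -/
theorem TrulyProjective.exists_eq_proj {G : LoopGraph V} (hG : G.TrulyProjective) [Finite W]
    {R : LoopGraph W} (hconn : R.Connected) (hcore : R.IsCore) (hinc : Incomparable R G) {s : ℕ}
    (hs : 2 ≤ s) (f : Hom ((G.pow s).prod R) G) (hf : ∀ x y, f (fun _ => x, y) = x) :
    ∃ i : Fin s, ∀ p, f p = p.1 i := by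
  obtain ⟨n, ⟨e⟩⟩ := Finite.exists_equiv_fin W
  let R' : LoopGraph (Fin n) := ⟨fun a b => R.Adj (e.symm a) (e.symm b), fun _ _ h => R.symm h⟩
  let to' : R.Hom R' := ⟨e, fun {a b} h => by simpa [R'] using h⟩
  let back : R'.Hom R := ⟨e.symm, fun {a b} h => h⟩
  have hconn' : R'.Connected := by
    refine ⟨hconn.1.map e, fun a b => ?_⟩
    have := (hconn.2 (e.symm a) (e.symm b)).lift (p := R'.Adj) e fun _ _ h => to'.map_rel h
    simpa [Function.onFun] using this
  have hcore' : R'.IsCore := by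
    refine isCore_of_surjective fun g x => ?_
    obtain ⟨y, hy⟩ := surjective_of_isCore hcore (back.comp (g.comp to')) (e.symm x)
    exact ⟨e y, e.symm.injective hy⟩
  have hinc' : Incomparable R' G :=
    ⟨⟨fun g => hinc.1.false (g.comp to')⟩, ⟨fun g => hinc.2.false (back.comp g)⟩⟩
  obtain ⟨i, hi⟩ := hG.2 s hs (Fin n) R' hconn' hcore' hinc'
    ⟨fun p => f (p.1, e.symm p.2), fun {p q} h => f.map_rel (show _ ∧ _ from ⟨h.1, h.2⟩)⟩
    (fun x y => hf x _)
  refine ⟨i, fun p => ?_⟩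
  have := hi (p.1, e p.2)
  simpa using this

/-- The factors of a core are incomparable, unless one of them is degenerate. -/
theorem incomparable_of_prod_isCore [Nontrivial V] [Nontrivial W] {G : LoopGraph V}
    {H : LoopGraph W} [Finite V] [Finite W] (h : (G.prod H).IsCore) : Incomparable H G := by
  constructor <;> refine ⟨fun g => ?_⟩
  · have hs := surjective_of_isCore h ⟨fun p => (g p.2, p.2), fun hpq => ⟨g.map_rel hpq.2, hpq.2⟩⟩
    obtain ⟨a, b, hab⟩ := exists_pair_ne V
    obtain ⟨w⟩ : Nonempty W := inferInstance
    obtain ⟨p, hp⟩ := hs (a, w)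
    obtain ⟨q, hq⟩ := hs (b, w)
    have hpq : p.2 = q.2 := (congrArg Prod.snd hp).trans (congrArg Prod.snd hq).symm
    exact hab ((congrArg Prod.fst hp).symm.trans ((congrArg g hpq).trans (congrArg Prod.fst hq)))
  · have hs := surjective_of_isCore h ⟨fun p => (p.1, g p.1), fun hpq => ⟨hpq.1, g.map_rel hpq.1⟩⟩
    obtain ⟨a, b, hab⟩ := exists_pair_ne W
    obtain ⟨v⟩ : Nonempty V := inferInstance
    obtain ⟨p, hp⟩ := hs (v, a)
    obtain ⟨q, hq⟩ := hs (v, b)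
    have hpq : p.1 = q.1 := (congrArg Prod.fst hp).trans (congrArg Prod.fst hq).symm
    exact hab ((congrArg Prod.snd hp).symm.trans ((congrArg g hpq).trans (congrArg Prod.snd hq)))

/-- A homomorphism `G ^ 2 × H ^ 2 → G` that is the projection `i` on the diagonal of `H ^ 2` is
that projection everywhere. -/
theorem eq_proj_of_diagonal [Finite V] {G : LoopGraph V} {H : LoopGraph W} (hcore : G.IsCore)
    (hG : ∀ a, ∃ b, G.Adj a b) (hH : ∀ a, ∃ b, H.Adj a b) (heven : ∀ a b, H.EvenReach a b)
    (F : (Fin 2 → V) → W → W → V)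
    (hF : ∀ p q y z y' z', (G.pow 2).Adj p q → H.Adj y z → H.Adj y' z' →
      G.Adj (F p y y') (F q z z'))
    (i : Fin 2) (hi : ∀ p y, F p y y = p i) (p : Fin 2 → V) (y y' : W) : F p y y' = p i := by
  -- Every neighbour `c` of `p i` is the `i`-th entry of a neighbour of `p`, so `F p z z'` is
  -- adjacent to all neighbours of `p i`; in a core the two coincide.
  have step : ∀ y z y' z', H.Adj y z → H.Adj y' z' → (∀ p, F p y y' = p i) →
      ∀ p, F p z z' = p i := by
    intro y z y' z' hz hz' h p
    refine (hcore.eq_of_neighbors_subset fun c hc => ?_).symm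
    choose nb hnb using hG
    have := hF p (Function.update (fun j => nb (p j)) i c) z y z' y'
      (fun j => by
        by_cases hj : j = i
        · subst hj; simpa using hc
        · simpa [hj] using hnb (p j)) (H.symm hz) (H.symm hz')
    rw [h] at this
    simpa using this
  revert p
  induction heven y y' with
  | refl => exact fun p => hi p y
  | tail _ hs ih =>
    obtain ⟨m, h₁, h₂⟩ := hs
    obtain ⟨z, hz⟩ := hH y
    -- While `y'` advances by two edges, `y` goes to `z` and back; hence the need for even walks.
    exact step _ _ _ _ (H.symm hz) h₂ (step _ _ _ _ hz h₁ ih)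

/-- Endomorphisms of `G × H` respect the factor `G`. -/
theorem TrulyProjective.fst_endomorphism [Finite V] [Finite W] {G : LoopGraph V} {H : LoopGraph W}
    (hG : G.TrulyProjective) (hH : H.Connected) (hcore : (G.prod H).IsCore)
    (hinc : Incomparable H G) (hGadj : ∀ a, ∃ b, G.Adj a b) (hHadj : ∀ a, ∃ b, H.Adj a b)
    (σ : (G.prod H).Hom (G.prod H)) (a : V) (b b' : W) : (σ (a, b)).1 = (σ (a, b')).1 := by
  obtain ⟨τ, hτσ, hστ⟩ := exists_inverse_hom σ (surjective_of_isCore hcore σ)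
  have : Nonempty V := ⟨a⟩
  have : Nonempty W := ⟨b⟩
  -- For `y = y'` and `p 0 = p 1`, `τ` is undone by `σ`, so `F` is idempotent there.
  let F : (Fin 2 → V) → W → W → V := fun p y y' => (σ ((τ (p 0, y)).1, (τ (p 1, y')).2)).1
  have hF : ∀ p q y z y' z', (G.pow 2).Adj p q → H.Adj y z → H.Adj y' z' →
      G.Adj (F p y y') (F q z z') := by
    intro p q y z y' z' hp hy hy'
    have h₀ : (G.prod H).Adj (τ (p 0, y)) (τ (q 0, z)) := τ.map_rel ⟨hp 0, hy⟩
    have h₁ : (G.prod H).Adj (τ (p 1, y')) (τ (q 1, z')) := τ.map_rel ⟨hp 1, hy'⟩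
    exact (σ.map_rel (show (G.prod H).Adj ((τ (p 0, y)).1, (τ (p 1, y')).2)
      ((τ (q 0, z)).1, (τ (q 1, z')).2) from ⟨h₀.1, h₁.2⟩)).1
  obtain ⟨i, hi⟩ := hG.exists_eq_proj hH (isCore_of_prod_right hcore) hinc le_rfl
    ⟨fun p => F p.1 p.2 p.2, fun {p q} h => hF _ _ _ _ _ _ h.1 h.2 h.2⟩
    (fun x y => by simp [F, hστ])
  obtain ⟨c, hc⟩ := hGadj a
  have key := eq_proj_of_diagonal (isCore_of_prod_left hcore) hGadj hHadj
    (hH.evenReach hc hinc.1) F hF i (fun p y => hi (p, y))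
  have val : ∀ x x' y y', (σ ((τ (x, y)).1, (τ (x', y')).2)).1 = ![x, x'] i :=
    fun x x' y y' => key ![x, x'] y y'
  have val' : ∀ p q : V × W, (σ (p.1, q.2)).1 = ![(σ p).1, (σ q).1] i := by
    intro p q
    have := val (σ p).1 (σ q).1 (σ p).2 (σ q).2
    simpa [hτσ] using this
  fin_cases i
  · rw [val' (a, b) (a, b), val' (a, b) (a, b')]; rfl
  -- For the second projection, `(σ (a, y)).1` would not depend on `a`; replacing `a` by its
  -- neighbour `c` at one end of an edge gives a homomorphism `H → G`.
  · refine (hinc.1.false ⟨fun y => (σ (a, y)).1, fun {y z} h => ?_⟩).elim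
    have h₁ : (σ (a, z)).1 = (σ (c, z)).1 := by rw [val' (a, z) (c, z)]; rfl
    rw [h₁]
    exact (σ.map_rel (show (G.prod H).Adj (a, y) (c, z) from ⟨hc, h⟩)).1

/-- The ordered adjacent pairs of a graph can be listed by twice as many indices as there are
edges. -/
theorem exists_dart_enumeration [Finite V] (G : LoopGraph V) :
    ∃ d : Fin (2 * G.edgeSet.ncard) → V × V,
      (∀ i, G.Adj (d i).1 (d i).2) ∧ ∀ x y, G.Adj x y → ∃ i, d i = (x, y) := by
  have hfin : Finite G.edgeSet := inferInstance
  let e : G.edgeSet ≃ Fin G.edgeSet.ncard := Finite.equivFin G.edgeSet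
  choose l r hadj heq using fun t : G.edgeSet => t.2
  -- Each edge is listed in both orientations; a loop appears twice, which is harmless.
  let dart : Fin 2 × Fin G.edgeSet.ncard → V × V := fun p =>
    if p.1 = 0 then (l (e.symm p.2), r (e.symm p.2)) else (r (e.symm p.2), l (e.symm p.2))
  refine ⟨fun i => dart (finProdFinEquiv.symm i), fun i => ?_, fun x y hxy => ?_⟩
  · dsimp only [dart]
    split_ifs
    · exact hadj _
    · exact G.symm (hadj _)
  · have ht := heq ⟨s(x, y), x, y, hxy, rfl⟩
    rcases Sym2.eq_iff.1 ht with ⟨h₁, h₂⟩ | ⟨h₁, h₂⟩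
    · exact ⟨finProdFinEquiv (0, e ⟨s(x, y), x, y, hxy, rfl⟩), by simp [dart, ← h₁, ← h₂]⟩
    · exact ⟨finProdFinEquiv (1, e ⟨s(x, y), x, y, hxy, rfl⟩), by simp [dart, ← h₁, ← h₂]⟩

/-- Up to an automorphism of `G`, the first coordinate of a homomorphism `G ^ m × H → G × H` is a
projection. -/
theorem TrulyProjective.exists_fst_eq [Finite V] [Finite W] {G : LoopGraph V} {H : LoopGraph W}
    (hG : G.TrulyProjective) (hH : H.Connected) (hcore : (G.prod H).IsCore)
    (hinc : Incomparable H G) (hGadj : ∀ a, ∃ b, G.Adj a b) (hHadj : ∀ a, ∃ b, H.Adj a b) {m : ℕ}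
    (hm : 2 ≤ m) (f : ((G.pow m).prod H).Hom (G.prod H)) :
    ∃ (α : G.Hom G) (i : Fin m), ∀ p, (f p).1 = α (p.1 i) := by
  obtain ⟨w⟩ := hH.1
  let σ : (G.prod H).Hom (G.prod H) :=
    ⟨fun p => f (fun _ => p.1, p.2), fun h => f.map_rel (show _ ∧ _ from ⟨fun _ => h.1, h.2⟩)⟩
  have hσ := hG.fst_endomorphism hH hcore hinc hGadj hHadj σ
  obtain ⟨w', hw⟩ := hHadj w
  let α : G.Hom G := ⟨fun x => (σ (x, w)).1, fun {x y} h => by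
    rw [hσ y w w']
    exact (σ.map_rel (show (G.prod H).Adj (x, w) (y, w') from ⟨h, hw⟩)).1⟩
  have hα : Function.Surjective α := fun x => by
    obtain ⟨p, hp⟩ := surjective_of_isCore hcore σ (x, w)
    exact ⟨p.1, (hσ p.1 w p.2).trans (congrArg Prod.fst hp)⟩
  obtain ⟨β, hβα, hαβ⟩ := exists_inverse_hom α hα
  have : Nonempty V := (Nat.card_pos_iff.1 (by have := hG.1; omega)).1
  -- Composing with `β`, the inverse of `α`, makes the map idempotent on the diagonal.
  obtain ⟨i, hi⟩ := hG.exists_eq_proj hH (isCore_of_prod_right hcore) hinc hm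
    ⟨fun p => β (f p).1, fun h => β.map_rel (f.map_rel h).1⟩
    (fun x y => by
      have : (f (fun _ => x, y)).1 = α x := hσ x y w
      change β (f (fun _ => x, y)).1 = x
      rw [this, hβα])
  refine ⟨α, i, fun p => ?_⟩
  rw [← hi p]
  exact (hαβ _).symm

end LoopGraph

theorem mainTheorem9 {V₁ V₂ : Type*} [Finite V₁] [Finite V₂]
    (H₁ : LoopGraph V₁) (R : LoopGraph V₂)
    (hconn : (H₁.prod R).Connected) (hcore : (H₁.prod R).IsCore)
    (hnontriv : ¬ (H₁.prod R).IsTrivial)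
    (hproj : H₁.TrulyProjective)
    (hR : IsEmpty (R.Iso LoopGraph.loopVertex))
    (w : V₂) (s : ℕ) (hs : s = H₁.edgeSet.ncard) :
    ∃ u v : (Fin (2 * s) → V₁) × V₂,
      (∀ x y : V₁, H₁.Adj x y →
        ∃ f : ((H₁.pow (2 * s)).prod R).Hom (H₁.prod R), f u = (x, w) ∧ f v = (y, w)) ∧
      (∀ f : ((H₁.pow (2 * s)).prod R).Hom (H₁.prod R), H₁.Adj (f u).1 (f v).1) := by
  have hcard : 1 < Nat.card V₁ := by have := hproj.1; omega
  have : Nontrivial V₁ := Finite.one_lt_card_iff_nontrivial.1 hcard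
  have hRconn := LoopGraph.Connected.of_prod_right hconn
  have : Nonempty V₂ := ⟨w⟩
  have hadj := hconn.exists_adj
  have hadj₁ : ∀ a, ∃ b, H₁.Adj a b := fun a => (hadj (a, w)).elim fun q h => ⟨q.1, h.1⟩
  have hadj₂ : ∀ a, ∃ b, R.Adj a b := fun a =>
    (hadj (Classical.arbitrary V₁, a)).elim fun q h => ⟨q.2, h.2⟩
  -- A single vertex with a neighbour carries a loop, which `hR` excludes.
  have : Nontrivial V₂ := by
    by_contra hn
    have hsub : Subsingleton V₂ := not_nontrivial_iff_subsingleton.1 hn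
    obtain ⟨w', hw⟩ := hadj₂ w
    refine hR.false ⟨⟨fun _ => (), fun _ => w, fun _ => Subsingleton.elim _ _, fun _ => rfl⟩, ?_⟩
    intro a b
    refine ⟨fun _ => ?_, fun _ => trivial⟩
    rw [Subsingleton.elim a w, Subsingleton.elim b w']
    exact hw
  have hinc := LoopGraph.incomparable_of_prod_isCore hcore
  have hpos : 2 ≤ 2 * s := by
    obtain ⟨b, hb⟩ := hadj₁ (Classical.arbitrary V₁)
    have : 0 < H₁.edgeSet.ncard := (Set.ncard_pos (Set.toFinite _)).2 ⟨_, _, b, hb, rfl⟩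
    omega
  obtain ⟨d, hd, hsurj⟩ : ∃ d : Fin (2 * s) → V₁ × V₁,
      (∀ i, H₁.Adj (d i).1 (d i).2) ∧ ∀ x y, H₁.Adj x y → ∃ i, d i = (x, y) := by
    subst hs
    exact H₁.exists_dart_enumeration
  refine ⟨(fun i => (d i).1, w), (fun i => (d i).2, w), fun x y hxy => ?_, fun f => ?_⟩
  · obtain ⟨i, hi⟩ := hsurj x y hxy
    exact ⟨⟨fun p => (p.1 i, p.2), fun h => ⟨h.1 i, h.2⟩⟩,
      congrArg (fun e => (e.1, w)) hi, congrArg (fun e => (e.2, w)) hi⟩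
  · obtain ⟨α, i, h⟩ := hproj.exists_fst_eq hRconn hcore hinc hadj₁ hadj₂ hpos f
    rw [h, h]
    exact α.map_rel (hd i)
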